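/- Let $(M,+,0)$ be a commutative monoid. Write $\mathbb{N}=\{1,2,3,\dots\}$. For $a,b\in M$ define the canonical quasi-order by \[ a\lesssim b \iff \text{there exist } c,t\in M \text{ and } k\in\mathbb{N} \text{ such that } ka+c+t=kb+t, \] and define the asymptotic equivalence by \[ a\approx b \iff \text{there exists } d\in M \text{ such that } \ell a\lesssim \ell b+d \text{ and } \ell b\lesssim \ell a+d \text{ for all } \ell\in\mathbb{N}. \] Let $\mu\colon M\times M\to M$ be a biadditive binary operation, i.e. $\mu(a+a',b)=\mu(a,b)+\mu(a',b)$ and $\mu(b,a+a')=\mu(b,a)+\mu(b,a')$ for all $a,a',b\in M$. An element $s\in M$ is called $\mu$-localizable if for all $a,b\in M$ both of the following implications hold: \[ \mu(s,a)+a\lesssim\mu(s,b)+b \;\Longrightarrow\; a\lesssim b, \qquad \mu(a,s)+a\lesssim\mu(b,s)+b \;\Longrightarrow\; a\lesssim b. \] The monoid $M$ is called weakly $\mu$-localizable if for every $a\in M$ there is a $\mu$-localizable element $s\in M$ with $a\lesssim s$. **Theorem.** If $M$ is weakly $\mu$-localizable, then \[ \mu(a,b)\approx\mu(b,a) \qquad\text{and}\qquad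 \mu\bigl(\mu(a,b),c\bigr)\approx\mu\bigl(a,\mu(b,c)\bigr) \] hold for all $a,b,c\in M$. -/

import Mathlib

namespace MonoidLocalization

/-- A binary operation `μ` on a commutative monoid is biadditive if it is additive in each argument.
No compatibility with `0` is required. -/
structure IsBiadditive {M : Type*} [AddCommMonoid M] (μ : M → M → M) : Prop where
  add_left : ∀ a a' b : M, μ (a + a') b = μ a b + μ a' b
  add_right : ∀ b a a' : M, μ b (a + a') = μ b a + μ b a'

/-- The canonical quasi-order `a ≲ b` on a commutative monoid. -/
def CanonLE {M : Type*} [AddCommMonoid M] (a b : M) : Prop :=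
  ∃ (c t : M) (k : ℕ), 0 < k ∧ k • a + c + t = k • b + t

/-- The asymptotic equivalence `a ≈ b` on a commutative monoid. -/
def AsympEquiv {M : Type*} [AddCommMonoid M] (a b : M) : Prop :=
  ∃ d : M, ∀ l : ℕ, 0 < l → CanonLE (l • a) (l • b + d) ∧ CanonLE (l • b) (l • a + d)

/-- The opposite operation `μᵒᵖ (a, b) = μ (b, a)`. -/
def opOperation {M : Type*} (μ : M → M → M) : M → M → M :=
  fun a b => μ b a

/-- `s` is left `μ`-localizable. -/
def IsLeftLocalizable {M : Type*} [AddCommMonoid M] (μ : M → M → M) (s : M) : Prop :=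
  ∀ a b : M, CanonLE (μ s a + a) (μ s b + b) → CanonLE a b

/-- `s` is `μ`-localizable: left localizable for both `μ` and its opposite operation. -/
def IsLocalizable {M : Type*} [AddCommMonoid M] (μ : M → M → M) (s : M) : Prop :=
  IsLeftLocalizable μ s ∧ IsLeftLocalizable (opOperation μ) s

/-- `M` is weakly `μ`-localizable: each element is dominated by a `μ`-localizable one. -/
def IsWeaklyLocalizable (M : Type*) [AddCommMonoid M] (μ : M → M → M) : Prop :=
  ∀ a : M, ∃ s : M, IsLocalizable μ s ∧ CanonLE a s

end MonoidLocalization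

/-!
The relation `≲` is the restriction to `M` of a preorder on the Grothendieck group `G` of `M`: an
element is nonnegative if some positive multiple of it comes from `M`. Multiplications by fixed
elements extend to positive endomorphisms of `G`, and `s` is localizable precisely when the
endomorphisms `g ↦ s g + g` and `g ↦ g s + g` reflect the order.

Fix `d` in `M` and consider the states on the order ideal generated by `d`. By Hahn–Banach and
Krein–Milman, an element `x` of this ideal on which all pure states vanish satisfies `l x ≤ d` for
every `l > 0` (`nsmul_le_of_extremePoints_eq_zero`). So for each of the two identities it suffices
to find one `d` such that all pure states for `d` agree on both sides.

Let `f` be a pure state, `s` localizable and `a ≲ s`, and put `S g = s g + g`. As `S` reflects the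
order, Hahn–Banach gives a positive functional `F` on the order ideal of `S d` with `f = F ∘ S`.
On positive elements of the order ideal of `d`, both `F` and `g ↦ F (a g)` are below `F ∘ S = f`, so
purity makes them multiples of `f`. Consequently (`exists_scalar_or_infinite`) either
`f (a g) = r f g` for some scalar `r`, or `s` is infinite at `f` and `f g = 0` as soon as `g` and
`S g` lie in the order ideal. The same holds for multiplication from the right.

If `d` is the sum of the finitely many elements that occur, the infinite case makes `f` vanish on
both sides of the identity. Otherwise left multiplication by `a` and right multiplication by `c`
both act as scalars, which gives `f ((a b) c) = f (a (b c))`. For commutativity, either `f a = 0`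
and then `f (a b) = 0 = f (b a)`, or the two expressions for `f (a a)` show that `a` acts from the
left and from the right by the same scalar.

Real-valued functionals are constructed directly on abelian groups: minimal sublinear functions are
additive, and exist by Zorn's lemma.
-/

/-! ### Hahn–Banach for abelian groups -/

namespace MonoidLocalization

/-- A sublinear function on an abelian group: subadditive, and homogeneous for multiplication by
natural numbers. -/
structure IsGroupSublinear {G : Type*} [AddCommGroup G] (p : G → ℝ) : Prop where
  add_le : ∀ x y, p (x + y) ≤ p x + p y
  nsmul : ∀ (n : ℕ) (x : G), p (n • x) = n * p x

namespace IsGroupSublinear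

variable {G : Type*} [AddCommGroup G] {p : G → ℝ}

lemma map_zero (hp : IsGroupSublinear p) : p 0 = 0 := by
  simpa using hp.nsmul 0 0

lemma neg_le (hp : IsGroupSublinear p) (x : G) : -p (-x) ≤ p x := by
  have := hp.add_le x (-x)
  rw [add_neg_cancel, hp.map_zero] at this
  linarith

/-- The largest sublinear function below `p` that is additive in the direction `z`. -/
noncomputable def shift (p : G → ℝ) (z x : G) : ℝ := ⨅ n : ℕ, (p (x + n • z) - n * p z)

lemma bddBelow_shift (hp : IsGroupSublinear p) (z x : G) :
    BddBelow (Set.range fun n : ℕ => p (x + n • z) - n * p z) := by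
  refine ⟨-p (-x), ?_⟩
  rintro _ ⟨n, rfl⟩
  have h := hp.add_le (x + n • z) (-x)
  rw [show x + n • z + -x = n • z by abel, hp.nsmul] at h
  dsimp only
  linarith

lemma shift_le (hp : IsGroupSublinear p) (z x : G) (n : ℕ) :
    shift p z x ≤ p (x + n • z) - n * p z :=
  ciInf_le (hp.bddBelow_shift z x) n

lemma shift_le_self (hp : IsGroupSublinear p) (z x : G) : shift p z x ≤ p x := by
  simpa using hp.shift_le z x 0

lemma shift_neg_le (hp : IsGroupSublinear p) (z : G) : shift p z (-z) ≤ -p z := by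
  simpa [hp.map_zero] using hp.shift_le z (-z) 1

lemma antitone_shift (hp : IsGroupSublinear p) (z x : G) :
    Antitone fun n : ℕ => p (x + n • z) - n * p z := by
  refine antitone_nat_of_succ_le fun n => ?_
  have h := hp.add_le (x + n • z) z
  rw [add_assoc, ← succ_nsmul] at h
  push_cast
  linarith

lemma shift_isGroupSublinear (hp : IsGroupSublinear p) (z : G) :
    IsGroupSublinear (shift p z) where
  add_le x y := by
    refine le_ciInf_add_ciInf fun n m => ?_
    refine (hp.shift_le z (x + y) (n + m)).trans ?_
    have h := hp.add_le (x + n • z) (y + m • z)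
    rw [show x + n • z + (y + m • z) = x + y + (n + m) • z by rw [add_smul]; abel] at h
    push_cast
    linarith
  nsmul k x := by
    rcases Nat.eq_zero_or_pos k with rfl | hk
    · have h (n : ℕ) : p (0 + n • z) - n * p z = 0 := by rw [zero_add, hp.nsmul, sub_self]
      simp only [shift, zero_smul, h, ciInf_const, Nat.cast_zero, zero_mul]
    have key (n : ℕ) : p (k • x + (k * n) • z) - (k * n : ℕ) * p z =
        k * (p (x + n • z) - n * p z) := by
      rw [mul_smul, ← smul_add, hp.nsmul]
      push_cast
      ring
    apply le_antisymm
    · rw [shift, shift, Real.mul_iInf_of_nonneg (Nat.cast_nonneg k)]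
      exact le_ciInf fun n => (hp.shift_le z (k • x) (k * n)).trans (key n).le
    · refine le_ciInf fun n => ?_
      refine le_trans ?_ (hp.antitone_shift z (k • x) (Nat.le_mul_of_pos_left n hk))
      change _ ≤ p (k • x + (k * n) • z) - (k * n : ℕ) * p z
      rw [key]
      exact mul_le_mul_of_nonneg_left (hp.shift_le z x n) (Nat.cast_nonneg k)

/-- Infima of chains of sublinear functions are sublinear, so Zorn's lemma applies. -/
lemma exists_minimal_le (hp : IsGroupSublinear p) :
    ∃ q : G → ℝ, q ≤ p ∧ Minimal IsGroupSublinear q := by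
  suffices hchains : ∀ c ⊆ {q : (G → ℝ)ᵒᵈ | IsGroupSublinear (OrderDual.ofDual q)},
      IsChain (· ≤ ·) c → ∀ y ∈ c, ∃ ub ∈ {q : (G → ℝ)ᵒᵈ | IsGroupSublinear (OrderDual.ofDual q)},
        ∀ z ∈ c, z ≤ ub by
    obtain ⟨q, hq, hmin⟩ := zorn_le_nonempty₀ _ hchains (OrderDual.toDual p) hp
    exact ⟨OrderDual.ofDual q, hq, hmin.1, fun r hr hle => hmin.2 hr hle⟩
  intro c hc hchain y hy
  have : Nonempty c := ⟨⟨y, hy⟩⟩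
  let F : c → G → ℝ := fun q => OrderDual.ofDual q.1
  have hF (q : c) : IsGroupSublinear (F q) := hc q.2
  have htot (q r : c) : F q ≤ F r ∨ F r ≤ F q := by
    rcases hchain.total q.2 r.2 with h | h
    · exact Or.inr h
    · exact Or.inl h
  have hbdd (x : G) : BddBelow (Set.range fun q : c => F q x) := by
    refine ⟨-F ⟨y, hy⟩ (-x) ⊓ F ⟨y, hy⟩ x, ?_⟩
    rintro _ ⟨q, rfl⟩
    rcases htot q ⟨y, hy⟩ with h | h
    · refine inf_le_left.trans (le_trans ?_ ((hF q).neg_le x))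
      exact neg_le_neg (h (-x))
    · exact inf_le_right.trans (h x)
  refine ⟨OrderDual.toDual fun x => ⨅ q : c, F q x, ⟨fun x z => ?_, fun n x => ?_⟩,
    fun r hr x => ciInf_le (hbdd x) ⟨r, hr⟩⟩
  · refine le_ciInf_add_ciInf fun q r => ?_
    rcases htot q r with h | h
    · exact (ciInf_le (hbdd (x + z)) q).trans (((hF q).add_le x z).trans (by gcongr; exact h z))
    · exact (ciInf_le (hbdd (x + z)) r).trans (((hF r).add_le x z).trans (by gcongr; exact h x))
  · change ⨅ q : c, F q (n • x) = n * ⨅ q : c, F q x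
    rw [Real.mul_iInf_of_nonneg (Nat.cast_nonneg n)]
    simp only [(hF _).nsmul]

lemma _root_.Minimal.groupSublinear_add (hp : Minimal IsGroupSublinear p) (x z : G) :
    p (x + z) = p x + p z := by
  refine le_antisymm (hp.prop.add_le x z) ?_
  have h := hp.le_of_le (hp.prop.shift_isGroupSublinear z) (hp.prop.shift_le_self z) x
  have h' := h.trans (hp.prop.shift_le z x 1)
  simp only [one_smul, Nat.cast_one, one_mul] at h'
  linarith

/-- Hahn–Banach: a sublinear function dominates an additive one that touches it at `z`. -/
theorem exists_addMonoidHom_le (hp : IsGroupSublinear p) (z : G) :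
    ∃ F : G →+ ℝ, (∀ x, F x ≤ p x) ∧ F z = p z := by
  obtain ⟨q, hq, hmin⟩ := (hp.shift_isGroupSublinear z).exists_minimal_le
  refine ⟨AddMonoidHom.mk' q hmin.groupSublinear_add,
    fun x => (hq x).trans (hp.shift_le_self z x), ?_⟩
  have h1 := (hq z).trans (hp.shift_le_self z z)
  have h2 := (hq (-z)).trans (hp.shift_neg_le z)
  have h3 := hmin.prop.neg_le z
  change q z = p z
  linarith

end IsGroupSublinear

section Extension

variable {H G : Type*} [AddCommGroup H] [AddCommGroup G] [Preorder G] [IsOrderedAddMonoid G]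

/-- The values `f h / n` with `n • g ≤ j h`: the upper bounds for the value at `g` of a positive
functional extending `f` along `j`. -/
def upperValues (j : H →+ G) (f : H →+ ℝ) (g : G) : Set ℝ :=
  {r | ∃ n : ℕ, 0 < n ∧ ∃ h : H, n • g ≤ j h ∧ r = f h / n}

/-- The infimum of the upper values is the sublinear function to which Hahn–Banach is applied. -/
lemma isGroupSublinear_sInf_upperValues (j : H →+ G) (f : H →+ ℝ)
    (hf : ∀ h, 0 ≤ j h → 0 ≤ f h) (hcof : ∀ g, ∃ h, g ≤ j h) :
    (∀ g, BddBelow (upperValues j f g)) ∧ (∀ g, (upperValues j f g).Nonempty) ∧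
      IsGroupSublinear fun g => sInf (upperValues j f g) := by
  have hbdd (g : G) : BddBelow (upperValues j f g) := by
    obtain ⟨h', hh'⟩ := hcof (-g)
    refine ⟨-f h', ?_⟩
    rintro _ ⟨n, hn, h, hle, rfl⟩
    have h0 : 0 ≤ j (h + n • h') := by
      rw [map_add, map_nsmul]
      calc (0 : G) = n • g + n • (-g) := by rw [← smul_add, add_neg_cancel, smul_zero]
        _ ≤ _ := add_le_add hle (nsmul_le_nsmul_right hh' n)
    have h1 := hf _ h0
    rw [map_add, map_nsmul, nsmul_eq_mul] at h1
    have hn' : (0 : ℝ) < n := Nat.cast_pos.2 hn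
    rw [le_div_iff₀ hn']
    linarith
  have hne (g : G) : (upperValues j f g).Nonempty := by
    obtain ⟨h, hh⟩ := hcof g
    exact ⟨_, 1, one_pos, h, by simpa using hh, rfl⟩
  refine ⟨hbdd, hne, fun x y => ?_, fun k x => ?_⟩
  · refine le_of_forall_pos_lt_add fun ε hε => ?_
    obtain ⟨_, ⟨n, hn, h, hle, rfl⟩, h1⟩ :=
      exists_lt_of_csInf_lt (hne x) (lt_add_of_pos_right _ (half_pos hε))
    obtain ⟨_, ⟨m, hm, h', hle', rfl⟩, h2⟩ :=
      exists_lt_of_csInf_lt (hne y) (lt_add_of_pos_right _ (half_pos hε))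
    have hmem : f h / n + f h' / m ∈ upperValues j f (x + y) := by
      refine ⟨n * m, Nat.mul_pos hn hm, m • h + n • h', ?_, ?_⟩
      · rw [map_add, map_nsmul, map_nsmul, smul_add]
        refine add_le_add ?_ ?_
        · rw [mul_comm, mul_smul]
          exact nsmul_le_nsmul_right hle m
        · rw [mul_smul]
          exact nsmul_le_nsmul_right hle' n
      · have hn' : (n : ℝ) ≠ 0 := Nat.cast_ne_zero.2 hn.ne'
        have hm' : (m : ℝ) ≠ 0 := Nat.cast_ne_zero.2 hm.ne'
        rw [map_add, map_nsmul, map_nsmul, nsmul_eq_mul, nsmul_eq_mul]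
        push_cast
        field_simp
    have := csInf_le (hbdd (x + y)) hmem
    linarith
  · rcases Nat.eq_zero_or_pos k with rfl | hk
    · simp only [zero_smul, Nat.cast_zero, zero_mul]
      refine le_antisymm (csInf_le (hbdd 0) ⟨1, one_pos, 0, by simp, by simp⟩) ?_
      refine le_csInf (hne 0) ?_
      rintro _ ⟨n, hn, h, hle, rfl⟩
      exact div_nonneg (hf h (by simpa using hle)) (Nat.cast_nonneg n)
    have hk' : (0 : ℝ) < k := Nat.cast_pos.2 hk
    apply le_antisymm
    · rw [← div_le_iff₀' hk']
      refine le_csInf (hne x) ?_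
      rintro _ ⟨n, hn, h, hle, rfl⟩
      rw [div_le_iff₀' hk']
      refine csInf_le (hbdd _) ⟨n, hn, k • h, ?_, ?_⟩
      · rw [smul_comm, map_nsmul]
        exact nsmul_le_nsmul_right hle k
      · rw [map_nsmul, nsmul_eq_mul, mul_div_assoc]
    · refine le_csInf (hne _) ?_
      rintro _ ⟨n, hn, h, hle, rfl⟩
      rw [← le_div_iff₀' hk']
      refine csInf_le (hbdd _) ⟨n * k, Nat.mul_pos hn hk, h, by rwa [mul_smul], ?_⟩
      push_cast
      rw [div_div]

/-- Extension of a positive functional `f` along a homomorphism `j` with cofinal range. The last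
clause says that the value of the extension at a given `x` can be chosen maximal. -/
theorem exists_positive_extension (j : H →+ G) (f : H →+ ℝ)
    (hf : ∀ h, 0 ≤ j h → 0 ≤ f h) (hcof : ∀ g, ∃ h, g ≤ j h) (x : G) :
    ∃ F : G →+ ℝ, (∀ g, 0 ≤ g → 0 ≤ F g) ∧ (∀ h, F (j h) = f h) ∧
      ∀ r, F x < r → ∃ n : ℕ, 0 < n ∧ ∃ h, n • x ≤ j h ∧ f h < n * r := by
  obtain ⟨hbdd, hne, hp⟩ := isGroupSublinear_sInf_upperValues j f hf hcof
  obtain ⟨F, hF, hFx⟩ := hp.exists_addMonoidHom_le x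
  have hle (h : H) : F (j h) ≤ f h :=
    (hF _).trans (csInf_le (hbdd _) ⟨1, one_pos, h, by simp, by simp⟩)
  refine ⟨F, fun g hg => ?_, fun h => ?_, fun r hr => ?_⟩
  · have h0 : F (-g) ≤ 0 :=
      (hF _).trans (csInf_le (hbdd _) ⟨1, one_pos, 0, by simpa using hg, by simp⟩)
    rw [map_neg] at h0
    linarith
  · refine le_antisymm (hle h) ?_
    have := hle (-h)
    rw [map_neg, map_neg, map_neg] at this
    linarith
  · rw [hFx] at hr
    obtain ⟨_, ⟨n, hn, h, hle, rfl⟩, h1⟩ := exists_lt_of_csInf_lt (hne x) hr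
    refine ⟨n, hn, h, hle, ?_⟩
    rwa [div_lt_iff₀' (Nat.cast_pos.2 hn)] at h1

end Extension

end MonoidLocalization

/-! ### Order ideals and their states -/

namespace MonoidLocalization

section States

variable {G : Type*} [AddCommGroup G] [Preorder G] [IsOrderedAddMonoid G] {d e x : G} {f : G → ℝ}

/-- The subgroup of all elements lying between two multiples of `d`. -/
def orderIdeal (d : G) : AddSubgroup G where
  carrier := {g | ∃ k : ℕ, g ≤ k • d ∧ -g ≤ k • d}
  zero_mem' := ⟨0, by simp, by simp⟩
  add_mem' := by
    rintro a b ⟨k, h1, h2⟩ ⟨m, h3, h4⟩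
    refine ⟨k + m, ?_, ?_⟩
    · rw [add_smul]
      exact add_le_add h1 h3
    · rw [add_smul, neg_add]
      exact add_le_add h2 h4
  neg_mem' := by
    rintro a ⟨k, h1, h2⟩
    exact ⟨k, h2, by rwa [neg_neg]⟩

lemma mem_orderIdeal_of_le (hx : 0 ≤ x) (hxd : x ≤ d) : x ∈ orderIdeal d := by
  refine ⟨1, by rwa [one_smul], ?_⟩
  rw [one_smul]
  exact (neg_nonpos.2 hx).trans (hx.trans hxd)

lemma self_mem_orderIdeal (hd : 0 ≤ d) : d ∈ orderIdeal d := mem_orderIdeal_of_le hd le_rfl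

lemma map_mem_orderIdeal {A : G →+ G} (hA : ∀ g, 0 ≤ g → 0 ≤ A g) (hAd : A d ≤ e)
    (hx : x ∈ orderIdeal d) : A x ∈ orderIdeal e := by
  have mono {a b : G} (h : a ≤ b) : A a ≤ A b := by
    have := hA _ (sub_nonneg.2 h)
    rwa [map_sub, sub_nonneg] at this
  obtain ⟨k, h1, h2⟩ := hx
  refine ⟨k, (mono h1).trans ?_, ?_⟩
  · rw [map_nsmul]
    exact nsmul_le_nsmul_right hAd k
  · rw [← map_neg]
    refine (mono h2).trans ?_
    rw [map_nsmul]
    exact nsmul_le_nsmul_right hAd k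

/-- A positive homomorphism `A` with `A d ≤ e`, as a map between the order ideals. -/
def orderIdealMap (A : G →+ G) (hA : ∀ g, 0 ≤ g → 0 ≤ A g) (hAd : A d ≤ e) :
    orderIdeal d →+ orderIdeal e :=
  (A.comp (orderIdeal d).subtype).codRestrict (orderIdeal e)
    fun g => map_mem_orderIdeal hA hAd g.2

/-- The states of the order ideal of `d`: positive additive functions normalized at `d`. They are
encoded as functions on all of `G` that vanish outside the order ideal, so that they form a subset
of the locally convex space `G → ℝ`. -/
structure IsState (d : G) (f : G → ℝ) : Prop where
  map_add : ∀ x ∈ orderIdeal d, ∀ y ∈ orderIdeal d, f (x + y) = f x + f y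
  nonneg : ∀ x ∈ orderIdeal d, 0 ≤ x → 0 ≤ f x
  map_self : f d = 1
  map_of_notMem : ∀ x ∉ orderIdeal d, f x = 0

/-- A state as a homomorphism on the order ideal. -/
def IsState.toHom (hf : IsState d f) : orderIdeal d →+ ℝ :=
  AddMonoidHom.mk' (fun g => f g) fun x y => hf.map_add x x.2 y y.2

@[simp]
lemma IsState.toHom_apply (hf : IsState d f) (g : orderIdeal d) : hf.toHom g = f g := rfl

open Classical in
/-- Extension by zero of a homomorphism on the order ideal. -/
noncomputable def extendByZero (F : orderIdeal d →+ ℝ) (g : G) : ℝ :=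
  if h : g ∈ orderIdeal d then F ⟨g, h⟩ else 0

lemma extendByZero_of_mem (F : orderIdeal d →+ ℝ) {g : G} (h : g ∈ orderIdeal d) :
    extendByZero F g = F ⟨g, h⟩ := dif_pos h

lemma extendByZero_of_notMem (F : orderIdeal d →+ ℝ) {g : G} (h : g ∉ orderIdeal d) :
    extendByZero F g = 0 := dif_neg h

lemma isState_extendByZero (hd : 0 ≤ d) (F : orderIdeal d →+ ℝ)
    (hF : ∀ g : orderIdeal d, 0 ≤ (g : G) → 0 ≤ F g)
    (h1 : F ⟨d, self_mem_orderIdeal hd⟩ = 1) : IsState d (extendByZero F) where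
  map_add x hx y hy := by
    rw [extendByZero_of_mem F hx, extendByZero_of_mem F hy, extendByZero_of_mem F (add_mem hx hy),
      ← map_add]
    rfl
  nonneg x hx h0 := by
    rw [extendByZero_of_mem F hx]
    exact hF _ h0
  map_self := by rw [extendByZero_of_mem F (self_mem_orderIdeal hd), h1]
  map_of_notMem x hx := extendByZero_of_notMem F hx

lemma abs_le_of_mem_orderIdeal (hd : 0 ≤ d) (F : orderIdeal d →+ ℝ)
    (hF : ∀ g : orderIdeal d, 0 ≤ (g : G) → 0 ≤ F g) (g : orderIdeal d) {k : ℕ}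
    (h1 : (g : G) ≤ k • d) (h2 : -(g : G) ≤ k • d) : |F g| ≤ k * F ⟨d, self_mem_orderIdeal hd⟩ := by
  have a1 := hF (k • ⟨d, self_mem_orderIdeal hd⟩ - g) (by simpa using h1)
  have a2 := hF (k • ⟨d, self_mem_orderIdeal hd⟩ + g) (by
    simpa [neg_le_iff_add_nonneg] using h2)
  rw [map_sub, map_nsmul, nsmul_eq_mul] at a1
  rw [map_add, map_nsmul, nsmul_eq_mul] at a2
  rw [abs_le]
  constructor <;> linarith

lemma eq_zero_of_map_self_eq_zero (hd : 0 ≤ d) (F : orderIdeal d →+ ℝ)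
    (hF : ∀ g : orderIdeal d, 0 ≤ (g : G) → 0 ≤ F g) (h0 : F ⟨d, self_mem_orderIdeal hd⟩ = 0)
    (g : orderIdeal d) : F g = 0 := by
  obtain ⟨k, h1, h2⟩ := g.2
  have := abs_le_of_mem_orderIdeal hd F hF g h1 h2
  rw [h0, mul_zero] at this
  exact abs_nonpos_iff.1 this

/-- The characteristic property of a pure state: it dominates only its own multiples. -/
lemma exists_eq_mul_of_le_extremePoint (hd : 0 ≤ d)
    (hf : f ∈ Set.extremePoints ℝ {f | IsState d f}) (F : orderIdeal d →+ ℝ)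
    (hF : ∀ g : orderIdeal d, 0 ≤ (g : G) → 0 ≤ F g)
    (hFf : ∀ g : orderIdeal d, 0 ≤ (g : G) → F g ≤ f g) :
    ∃ c : ℝ, ∀ g, F g = c * f g := by
  have hs : IsState d f := hf.1
  set u : orderIdeal d := ⟨d, self_mem_orderIdeal hd⟩ with hu
  have hfu : f u = 1 := hs.map_self
  have hF' : ∀ g : orderIdeal d, 0 ≤ (g : G) → 0 ≤ (hs.toHom - F) g := fun g hg => by
    simpa using hFf g hg
  refine ⟨F u, fun g => ?_⟩
  rcases (hF u hd).eq_or_lt with h0 | h0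
  · rw [eq_zero_of_map_self_eq_zero hd F hF h0.symm g, ← h0, zero_mul]
  rcases (hFf u hd).eq_or_lt with h1 | h1
  · have := eq_zero_of_map_self_eq_zero hd (hs.toHom - F) hF' (by simp [← hu, hfu, h1]) g
    rw [AddMonoidHom.sub_apply, hs.toHom_apply, sub_eq_zero] at this
    rw [h1, hfu, one_mul, this]
  rw [hfu] at h1
  have h1' : 0 < 1 - F u := sub_pos.2 h1
  -- `f` is a proper convex combination of the normalizations of `F` and of `f - F`
  have s1 := isState_extendByZero hd ((F u)⁻¹ • F)
    (fun g hg => mul_nonneg (inv_nonneg.2 h0.le) (hF g hg)) (inv_mul_cancel₀ h0.ne')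
  have s2 := isState_extendByZero hd ((1 - F u)⁻¹ • (hs.toHom - F))
    (fun g hg => mul_nonneg (inv_nonneg.2 h1'.le) (hF' g hg)) (by
      change (1 - F u)⁻¹ * (f u - F u) = 1
      rw [hfu, inv_mul_cancel₀ h1'.ne'])
  have hseg : f ∈ openSegment ℝ (extendByZero ((F u)⁻¹ • F))
      (extendByZero ((1 - F u)⁻¹ • (hs.toHom - F))) := by
    refine ⟨F u, 1 - F u, h0, h1', by ring, ?_⟩
    ext y
    by_cases hy : y ∈ orderIdeal d
    · simp only [Pi.add_apply, Pi.smul_apply, extendByZero_of_mem _ hy, AddMonoidHom.smul_apply,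
        AddMonoidHom.sub_apply, hs.toHom_apply, smul_eq_mul, mul_inv_cancel_left₀ h0.ne',
        mul_inv_cancel_left₀ h1'.ne']
      ring
    · simp [extendByZero_of_notMem _ hy, hs.map_of_notMem y hy]
  have heq := congrFun (hf.2 s1 s2 hseg) g
  rw [extendByZero_of_mem _ g.2] at heq
  change (F u)⁻¹ * F g = f g at heq
  rw [← heq, mul_inv_cancel_left₀ h0.ne']

lemma convex_setOf_isState (d : G) : Convex ℝ {f : G → ℝ | IsState d f} := by
  intro f hf g hg a b ha hb hab
  refine ⟨fun x hx y hy => ?_, fun x hx h0 => ?_, ?_, fun x hx => ?_⟩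
  · simp only [Pi.add_apply, Pi.smul_apply, smul_eq_mul, hf.map_add x hx y hy, hg.map_add x hx y hy]
    ring
  · exact add_nonneg (mul_nonneg ha (hf.nonneg x hx h0)) (mul_nonneg hb (hg.nonneg x hx h0))
  · simp [hf.map_self, hg.map_self, hab]
  · simp [hf.map_of_notMem x hx, hg.map_of_notMem x hx]

lemma isCompact_setOf_isState (hd : 0 ≤ d) : IsCompact {f : G → ℝ | IsState d f} := by
  have hb (x : G) : ∃ b : ℝ, ∀ f, IsState d f → f x ∈ Set.Icc (-b) b := by
    by_cases hx : x ∈ orderIdeal d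
    · obtain ⟨k, h1, h2⟩ := hx
      refine ⟨k, fun f hf => abs_le.1 ?_⟩
      have := abs_le_of_mem_orderIdeal hd hf.toHom (fun g hg => hf.nonneg g g.2 hg)
        ⟨x, k, h1, h2⟩ h1 h2
      simpa [hf.map_self] using this
    · exact ⟨0, fun f hf => by simp [hf.map_of_notMem x hx]⟩
  choose b hb using hb
  refine (isCompact_univ_pi fun x => isCompact_Icc (a := -b x) (b := b x)).of_isClosed_subset ?_
    fun f hf x _ => hb x f hf
  have : {f : G → ℝ | IsState d f} =
      {f | ∀ x ∈ orderIdeal d, ∀ y ∈ orderIdeal d, f (x + y) = f x + f y} ∩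
      ({f | ∀ x ∈ orderIdeal d, 0 ≤ x → 0 ≤ f x} ∩
      ({f | f d = 1} ∩ {f | ∀ x ∉ orderIdeal d, f x = 0})) := by
    ext f
    exact ⟨fun h => ⟨h.1, h.2, h.3, h.4⟩, fun h => ⟨h.1, h.2.1, h.2.2.1, h.2.2.2⟩⟩
  rw [this]
  simp only [Set.ofPred_forall]
  refine IsClosed.inter ?_ (IsClosed.inter ?_ (IsClosed.inter ?_ ?_))
  · exact isClosed_iInter fun x => isClosed_iInter fun _ => isClosed_iInter fun y =>
      isClosed_iInter fun _ => isClosed_eq (by fun_prop) (by fun_prop)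
  · exact isClosed_iInter fun x => isClosed_iInter fun _ => isClosed_iInter fun _ =>
      isClosed_le (by fun_prop) (by fun_prop)
  · exact isClosed_eq (by fun_prop) (by fun_prop)
  · exact isClosed_iInter fun x => isClosed_iInter fun _ => isClosed_eq (by fun_prop) (by fun_prop)

/-- Pure states detect the elements that are infinitesimal with respect to `d`. By Krein–Milman an
element annihilated by the pure states is annihilated by all states, in particular by one with
maximal value at this element. -/
theorem nsmul_le_of_extremePoints_eq_zero
    (hG : ∀ (n : ℕ) (g : G), 0 < n → 0 ≤ n • g → 0 ≤ g) (hd : 0 ≤ d) (hx : x ∈ orderIdeal d)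
    (h : ∀ f ∈ Set.extremePoints ℝ {f | IsState d f}, f x = 0) {l : ℕ} (hl : 0 < l) :
    l • x ≤ d := by
  by_cases hd' : d ≤ 0
  · -- there are no states in this case, but every element of the order ideal is then below `0`
    obtain ⟨k, h1, -⟩ := hx
    exact (nsmul_nonpos (h1.trans (nsmul_nonpos hd' k)) l).trans hd
  have hall : ∀ f, IsState d f → f x = 0 := by
    have hsub : {f : G → ℝ | IsState d f} ⊆ {f | f x = 0} := by
      rw [← closure_convexHull_extremePoints (isCompact_setOf_isState hd) (convex_setOf_isState d)]
      refine closure_minimal (convexHull_min h ?_) (isClosed_eq (by fun_prop) (by fun_prop))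
      intro f hf g hg a b _ _ _
      simp only [Set.mem_ofPred_eq] at hf hg
      simp [hf, hg]
    exact hsub
  let u : orderIdeal d := ⟨d, self_mem_orderIdeal hd⟩
  obtain ⟨F, hF, hFu, hmax⟩ := exists_positive_extension (zmultiplesHom (orderIdeal d) u)
    (Int.castAddHom ℝ) (fun n hn => by
      by_contra hneg
      have hneg' : n < 0 := by
        rw [not_le] at hneg
        change (n : ℝ) < 0 at hneg
        exact_mod_cast hneg
      obtain ⟨m, rfl⟩ := Int.eq_negSucc_of_lt_zero hneg'
      have hn' : (0 : G) ≤ Int.negSucc m • d := hn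
      rw [negSucc_zsmul, ← smul_neg] at hn'
      exact hd' (neg_nonneg.1 (hG _ _ m.succ_pos hn')))
    (fun g => by
      obtain ⟨k, h1, -⟩ := g.2
      exact ⟨k, by simpa [← Subtype.coe_le_coe, u] using h1⟩) ⟨x, hx⟩
  have hFd : F u = 1 := by simpa using hFu 1
  have hF0 : F ⟨x, hx⟩ = 0 := by
    rw [← extendByZero_of_mem F hx]
    exact hall _ (isState_extendByZero hd F (fun g hg => hF g hg) hFd)
  have hl' : (0 : ℝ) < l := Nat.cast_pos.2 hl
  obtain ⟨n, hn, m, hle, hlt⟩ := hmax (1 / l) (by rw [hF0]; positivity)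
  have hle' : n • x ≤ m • d := hle
  have hml : (m * l : ℤ) ≤ n := by
    rw [mul_one_div, lt_div_iff₀ hl'] at hlt
    have : ((m * l : ℤ) : ℝ) < (n : ℤ) := by simpa using hlt
    exact (Int.cast_lt.1 this).le
  have key : 0 ≤ n • (d - l • x) := by
    rw [smul_sub, sub_nonneg, smul_comm]
    calc l • n • x ≤ l • m • d := nsmul_le_nsmul_right hle' l
      _ = (m * l : ℤ) • d := by rw [mul_comm, mul_smul, natCast_zsmul]
      _ ≤ (n : ℤ) • d := by
        obtain ⟨r, hr⟩ := Int.le.dest hml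
        rw [← hr, add_smul, natCast_zsmul]
        exact le_add_of_nonneg_right (nsmul_nonneg hd r)
      _ = n • d := natCast_zsmul d n
  exact sub_nonneg.1 (hG _ _ hn key)

/-- Let `S` be an order-reflecting homomorphism above the identity, and let `A` be a positive one
below `S`. With respect to a pure state `f`, either `A` acts as multiplication by a scalar, or `S`
is infinite in the sense that `f` vanishes at `g` whenever `g` and `S g` are in the order ideal.

Since `S` reflects the order, `f = F ∘ S` for some positive `F` on the order ideal of `S d`. Both
`F` and `F ∘ A` are dominated by `f`, hence they are multiples of `f`. -/
theorem exists_scalar_or_infinite (hd : 0 ≤ d)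
    (hf : f ∈ Set.extremePoints ℝ {f | IsState d f}) (S A : G →+ G)
    (hS : ∀ g, 0 ≤ S g → 0 ≤ g) (hSle : ∀ g, 0 ≤ g → g ≤ S g)
    (hA : ∀ g, 0 ≤ g → 0 ≤ A g) (hAS : ∀ g, 0 ≤ g → A g ≤ S g) :
    (∃ r : ℝ, ∀ g ∈ orderIdeal d, A g ∈ orderIdeal d → f (A g) = r * f g) ∨
      ∀ g ∈ orderIdeal d, S g ∈ orderIdeal d → f g = 0 := by
  have hs : IsState d f := hf.1
  have hS0 : ∀ g, 0 ≤ g → 0 ≤ S g := fun g hg => hg.trans (hSle g hg)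
  obtain ⟨F, hF, hFS, -⟩ := exists_positive_extension
    (orderIdealMap S hS0 (le_refl (S d))) hs.toHom
    (fun g hg => hs.nonneg g g.2 (hS g hg))
    (fun g => by
      obtain ⟨k, h1, -⟩ := g.2
      refine ⟨k • ⟨d, self_mem_orderIdeal hd⟩, ?_⟩
      rw [map_nsmul]
      exact h1) 0
  let J : orderIdeal d →+ orderIdeal (S d) :=
    orderIdealMap (AddMonoidHom.id G) (fun g hg => hg) (hSle d hd)
  let JA : orderIdeal d →+ orderIdeal (S d) := orderIdealMap A hA (hAS d hd)
  have hdom (B : orderIdeal d →+ orderIdeal (S d))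
      (hB : ∀ g : orderIdeal d, 0 ≤ (g : G) → 0 ≤ (B g : G))
      (hBS : ∀ g : orderIdeal d, 0 ≤ (g : G) → (B g : G) ≤ S g) :
      ∃ c : ℝ, ∀ g, F (B g) = c * f g := by
    refine exists_eq_mul_of_le_extremePoint hd hf (F.comp B) (fun g hg => hF _ (hB g hg)) ?_
    intro g hg
    have h1 := hF (orderIdealMap S hS0 (le_refl (S d)) g - B g) (sub_nonneg.2 (hBS g hg))
    rw [map_sub, hFS, sub_nonneg] at h1
    exact h1
  obtain ⟨c, hc⟩ := hdom J (fun g hg => hg) (fun g hg => hSle g hg)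
  obtain ⟨c', hc'⟩ := hdom JA (fun g hg => hA g hg) (fun g hg => hAS g hg)
  have hrel (g : G) (hg : g ∈ orderIdeal d) (hAg : A g ∈ orderIdeal d) :
      c * f (A g) = c' * f g := by
    rw [← hc ⟨A g, hAg⟩, ← hc' ⟨g, hg⟩]
    rfl
  rcases eq_or_ne c 0 with h0 | h0
  · refine Or.inr fun g hg hSg => ?_
    have h1 := hFS ⟨g, hg⟩
    have h2 := hc ⟨S g, hSg⟩
    rw [h0, zero_mul] at h2
    exact h1.symm.trans h2
  · refine Or.inl ⟨c' / c, fun g hg hAg => ?_⟩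
    rw [div_mul_eq_mul_div, eq_div_iff h0, mul_comm, hrel g hg hAg]

end States

end MonoidLocalization

/-! ### The canonical order on the Grothendieck group -/

namespace MonoidLocalization

open Algebra

section Grothendieck

variable {M : Type*} [AddCommMonoid M]

lemma of_eq_of_iff {a b : M} :
    GrothendieckAddGroup.of a = GrothendieckAddGroup.of b ↔ ∃ t, a + t = b + t := by
  refine ((AddLocalization.addMonoidOf (⊤ : AddSubmonoid M)).eq_iff_exists).trans ?_
  refine ⟨fun ⟨t, ht⟩ => ⟨t, by rwa [add_comm a, add_comm b]⟩,
    fun ⟨t, ht⟩ => ⟨⟨t, trivial⟩, by rwa [add_comm a, add_comm b] at ht⟩⟩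

lemma exists_eq_of_sub_of (g : GrothendieckAddGroup M) :
    ∃ a b : M, g = GrothendieckAddGroup.of a - GrothendieckAddGroup.of b := by
  obtain ⟨⟨a, b⟩, h⟩ := (AddLocalization.addMonoidOf (⊤ : AddSubmonoid M)).surj g
  exact ⟨a, b, eq_sub_of_add_eq h⟩

/-- The positive cone of the Grothendieck group: elements with a positive multiple in the image of
the monoid. -/
def canonCone (M : Type*) [AddCommMonoid M] : AddSubmonoid (GrothendieckAddGroup M) where
  carrier := {g | ∃ k : ℕ, 0 < k ∧ ∃ c : M, k • g = GrothendieckAddGroup.of c}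
  zero_mem' := ⟨1, one_pos, 0, by simp⟩
  add_mem' := by
    rintro g g' ⟨k, hk, c, hc⟩ ⟨k', hk', c', hc'⟩
    refine ⟨k * k', Nat.mul_pos hk hk', k' • c + k • c', ?_⟩
    rw [map_add, map_nsmul, map_nsmul, ← hc, ← hc', smul_add, smul_smul, smul_smul, mul_comm k' k]

/-- The canonical order on the Grothendieck group, with positive cone `canonCone M`. -/
instance canonPreorder : Preorder (GrothendieckAddGroup M) where
  le g g' := g' - g ∈ canonCone M
  le_refl g := by
    rw [sub_self]
    exact zero_mem _
  le_trans g g' g'' h h' := by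
    have := add_mem h' h
    rwa [sub_add_sub_cancel] at this

lemma canonCone_le_def {g g' : GrothendieckAddGroup M} : g ≤ g' ↔ g' - g ∈ canonCone M := Iff.rfl

instance canonIsOrderedAddMonoid : IsOrderedAddMonoid (GrothendieckAddGroup M) where
  add_le_add_left g g' h g'' := by rwa [canonCone_le_def, add_sub_add_right_eq_sub]

lemma nonneg_iff_exists {g : GrothendieckAddGroup M} :
    0 ≤ g ↔ ∃ k : ℕ, 0 < k ∧ ∃ c : M, k • g = GrothendieckAddGroup.of c := by
  rw [canonCone_le_def, sub_zero]
  rfl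

lemma of_nonneg (c : M) : 0 ≤ GrothendieckAddGroup.of c :=
  nonneg_iff_exists.2 ⟨1, one_pos, c, one_smul _ _⟩

lemma nonneg_of_nsmul_nonneg (n : ℕ) (g : GrothendieckAddGroup M) (hn : 0 < n) (h : 0 ≤ n • g) :
    0 ≤ g := by
  obtain ⟨k, hk, c, hc⟩ := nonneg_iff_exists.1 h
  exact nonneg_iff_exists.2 ⟨k * n, Nat.mul_pos hk hn, c, by rwa [mul_smul]⟩

lemma of_le_of_iff {a b : M} :
    GrothendieckAddGroup.of a ≤ GrothendieckAddGroup.of b ↔ CanonLE a b := by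
  rw [← sub_nonneg, nonneg_iff_exists, CanonLE]
  have key (k : ℕ) (c : M) :
      k • (GrothendieckAddGroup.of b - GrothendieckAddGroup.of a) = GrothendieckAddGroup.of c ↔
        ∃ t, k • a + c + t = k • b + t := by
    rw [← of_eq_of_iff, map_add, map_nsmul, map_nsmul, smul_sub, sub_eq_iff_eq_add, eq_comm,
      add_comm]
  simp only [key]
  exact ⟨fun ⟨k, hk, c, t, h⟩ => ⟨c, t, k, hk, h⟩, fun ⟨c, t, k, hk, h⟩ => ⟨k, hk, c, t, h⟩⟩

lemma of_mem_orderIdeal_of_sum {m : M} {l : List M} (h : m ∈ l) :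
    GrothendieckAddGroup.of m ∈ orderIdeal (GrothendieckAddGroup.of l.sum) := by
  refine mem_orderIdeal_of_le (of_nonneg m) ?_
  obtain ⟨l₁, l₂, rfl⟩ := List.append_of_mem h
  rw [List.sum_append, List.sum_cons, add_left_comm, map_add]
  exact le_add_of_nonneg_right (of_nonneg _)

/-- Two elements on which all pure states of some order ideal agree are asymptotically
equivalent. -/
lemma asympEquiv_of_extremePoints {x y d : M}
    (hx : GrothendieckAddGroup.of x ∈ orderIdeal (GrothendieckAddGroup.of d))
    (hy : GrothendieckAddGroup.of y ∈ orderIdeal (GrothendieckAddGroup.of d))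
    (h : ∀ f ∈ Set.extremePoints ℝ {f | IsState (GrothendieckAddGroup.of d) f},
      f (GrothendieckAddGroup.of x) = f (GrothendieckAddGroup.of y)) : AsympEquiv x y := by
  have key {x y : M}
      (hx : GrothendieckAddGroup.of x ∈ orderIdeal (GrothendieckAddGroup.of d))
      (hy : GrothendieckAddGroup.of y ∈ orderIdeal (GrothendieckAddGroup.of d))
      (h : ∀ f ∈ Set.extremePoints ℝ {f | IsState (GrothendieckAddGroup.of d) f},
        f (GrothendieckAddGroup.of x) = f (GrothendieckAddGroup.of y)) {l : ℕ} (hl : 0 < l) :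
      CanonLE (l • x) (l • y + d) := by
    have hmem := sub_mem hx hy
    have := nsmul_le_of_extremePoints_eq_zero nonneg_of_nsmul_nonneg (of_nonneg d) hmem
      (fun f hf => by
        have hs : IsState (GrothendieckAddGroup.of d) f := hf.1
        have := hs.map_add _ hmem _ hy
        rw [sub_add_cancel, h f hf] at this
        linarith) hl
    rw [smul_sub, sub_le_iff_le_add'] at this
    rw [← of_le_of_iff]
    simpa using this
  exact ⟨d, fun l hl => ⟨key hx hy h hl, key hy hx (fun f hf => (h f hf).symm) hl⟩⟩

end Grothendieck

/-! ### Multiplication by a fixed element -/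

section Multiplication

variable {M : Type*} [AddCommMonoid M] {μ : M → M → M}

lemma IsBiadditive.op (hμ : IsBiadditive μ) : IsBiadditive (opOperation μ) :=
  ⟨fun a a' b => hμ.add_right b a a', fun b a a' => hμ.add_left a a' b⟩

/-- Left multiplication by `a`, extended to the Grothendieck group. Additivity suffices for this:
`μ a 0` is idempotent, hence it becomes zero in the group. -/
noncomputable def IsBiadditive.leftMul (hμ : IsBiadditive μ) (a : M) :
    GrothendieckAddGroup M →+ GrothendieckAddGroup M :=
  GrothendieckAddGroup.lift (AddMonoidHom.mk' (fun m => GrothendieckAddGroup.of (μ a m))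
    fun m m' => by rw [hμ.add_right, map_add])

@[simp]
lemma IsBiadditive.leftMul_of (hμ : IsBiadditive μ) (a m : M) :
    hμ.leftMul a (GrothendieckAddGroup.of m) = GrothendieckAddGroup.of (μ a m) :=
  DFunLike.congr_fun (GrothendieckAddGroup.lift.symm_apply_apply
    (AddMonoidHom.mk' (fun m => GrothendieckAddGroup.of (μ a m))
      fun m m' => by rw [hμ.add_right, map_add])) m

lemma IsBiadditive.leftMul_nonneg (hμ : IsBiadditive μ) (a : M) (g : GrothendieckAddGroup M)
    (hg : 0 ≤ g) : 0 ≤ hμ.leftMul a g := by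
  obtain ⟨k, hk, c, hc⟩ := nonneg_iff_exists.1 hg
  exact nonneg_iff_exists.2 ⟨k, hk, μ a c, by rw [← map_nsmul, hc, hμ.leftMul_of]⟩

lemma IsBiadditive.leftMul_le (hμ : IsBiadditive μ) {a s : M} (has : CanonLE a s)
    (g : GrothendieckAddGroup M) (hg : 0 ≤ g) : hμ.leftMul a g ≤ hμ.leftMul s g := by
  obtain ⟨k, hk, c, hc⟩ := nonneg_iff_exists.1 hg
  rw [← sub_nonneg]
  refine nonneg_of_nsmul_nonneg k _ hk ?_
  rw [smul_sub, ← map_nsmul, ← map_nsmul, hc, hμ.leftMul_of, hμ.leftMul_of]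
  -- multiplication by `c` from the other side is positive, hence monotone
  have := hμ.op.leftMul_nonneg c _ (sub_nonneg.2 (of_le_of_iff.2 has))
  rwa [map_sub, hμ.op.leftMul_of, hμ.op.leftMul_of] at this

lemma IsLeftLocalizable.nonneg_of_add_nonneg {s : M} (hs : IsLeftLocalizable μ s)
    (hμ : IsBiadditive μ) (g : GrothendieckAddGroup M) (hg : 0 ≤ hμ.leftMul s g + g) : 0 ≤ g := by
  obtain ⟨x, y, rfl⟩ := exists_eq_of_sub_of g
  rw [map_sub, hμ.leftMul_of, hμ.leftMul_of, sub_add_sub_comm, ← map_add, ← map_add, sub_nonneg,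
    of_le_of_iff] at hg
  exact sub_nonneg.2 (of_le_of_iff.2 (hs _ _ hg))

/-- With respect to a pure state `f`, either multiplication by `a ≲ s` is multiplication by a
scalar, or `s` is infinite. -/
lemma IsLeftLocalizable.exists_scalar_or_infinite {a s : M} (hs : IsLeftLocalizable μ s)
    (hμ : IsBiadditive μ) (has : CanonLE a s) {d : GrothendieckAddGroup M} (hd : 0 ≤ d)
    {f : GrothendieckAddGroup M → ℝ} (hf : f ∈ Set.extremePoints ℝ {f | IsState d f}) :
    (∃ r : ℝ, ∀ m : M, GrothendieckAddGroup.of m ∈ orderIdeal d →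
        GrothendieckAddGroup.of (μ a m) ∈ orderIdeal d →
        f (GrothendieckAddGroup.of (μ a m)) = r * f (GrothendieckAddGroup.of m)) ∨
      ∀ m : M, GrothendieckAddGroup.of m ∈ orderIdeal d →
        GrothendieckAddGroup.of (μ s m) ∈ orderIdeal d → f (GrothendieckAddGroup.of m) = 0 := by
  rcases MonoidLocalization.exists_scalar_or_infinite hd hf
    (hμ.leftMul s + AddMonoidHom.id _) (hμ.leftMul a)
    (hs.nonneg_of_add_nonneg hμ)
    (fun g hg => le_add_of_nonneg_left (hμ.leftMul_nonneg s g hg))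
    (hμ.leftMul_nonneg a)
    (fun g hg => (hμ.leftMul_le has g hg).trans (le_add_of_nonneg_right hg)) with ⟨r, hr⟩ | h
  · refine Or.inl ⟨r, fun m hm hm' => ?_⟩
    rw [← hμ.leftMul_of] at hm' ⊢
    exact hr _ hm hm'
  · refine Or.inr fun m hm hm' => h _ hm ?_
    rw [← hμ.leftMul_of] at hm'
    exact add_mem hm' hm

theorem asympEquiv_assoc (hμ : IsBiadditive μ) (hloc : IsWeaklyLocalizable M μ) (a b c : M) :
    AsympEquiv (μ (μ a b) c) (μ a (μ b c)) := by
  obtain ⟨s, hs, has⟩ := hloc a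
  obtain ⟨t, ht, hct⟩ := hloc c
  set x := μ (μ a b) c with hx
  set y := μ a (μ b c) with hy
  have hmem {m : M} : m ∈ [b, μ a b, μ b c, x, y, μ s x, μ s y, μ x t, μ y t] →
    GrothendieckAddGroup.of m ∈ _ := of_mem_orderIdeal_of_sum
  refine asympEquiv_of_extremePoints (hmem (by simp)) (hmem (by simp)) fun f hf => ?_
  rcases hs.1.exists_scalar_or_infinite hμ has (of_nonneg _) hf with ⟨r, hr⟩ | h
  · rcases ht.2.exists_scalar_or_infinite hμ.op hct (of_nonneg _) hf with ⟨r', hr'⟩ | h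
    · have h1 := hr' (μ a b) (hmem (by simp)) (hmem (by simp [x, opOperation]))
      have h2 := hr b (hmem (by simp)) (hmem (by simp))
      have h3 := hr (μ b c) (hmem (by simp)) (hmem (by simp [y]))
      have h4 := hr' b (hmem (by simp)) (hmem (by simp [opOperation]))
      simp only [opOperation] at h1 h4
      rw [hx, hy, h1, h2, h3, h4]
      ring
    · rw [h x (hmem (by simp)) (hmem (by simp [opOperation])),
        h y (hmem (by simp)) (hmem (by simp [opOperation]))]
  · rw [h x (hmem (by simp)) (hmem (by simp)), h y (hmem (by simp)) (hmem (by simp))]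

theorem asympEquiv_comm (hμ : IsBiadditive μ) (hloc : IsWeaklyLocalizable M μ) (a b : M) :
    AsympEquiv (μ a b) (μ b a) := by
  obtain ⟨s, hs, has⟩ := hloc a
  obtain ⟨t, ht, hbt⟩ := hloc b
  set x := μ a b with hx
  set y := μ b a with hy
  have hmem {m : M} : m ∈ [a, b, μ a a, x, y, μ s x, μ s y, μ x s, μ y s, μ t x, μ t y, μ x t,
    μ y t] → GrothendieckAddGroup.of m ∈ _ := of_mem_orderIdeal_of_sum
  refine asympEquiv_of_extremePoints (hmem (by simp)) (hmem (by simp)) fun f hf => ?_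
  rcases hs.1.exists_scalar_or_infinite hμ has (of_nonneg _) hf with ⟨la, hla⟩ | h
  swap
  · rw [h x (hmem (by simp)) (hmem (by simp)), h y (hmem (by simp)) (hmem (by simp))]
  rcases hs.2.exists_scalar_or_infinite hμ.op has (of_nonneg _) hf with ⟨ra, hra⟩ | h
  swap
  · rw [h x (hmem (by simp)) (hmem (by simp [opOperation])),
      h y (hmem (by simp)) (hmem (by simp [opOperation]))]
  rcases ht.1.exists_scalar_or_infinite hμ hbt (of_nonneg _) hf with ⟨lb, hlb⟩ | h
  swap
  · rw [h x (hmem (by simp)) (hmem (by simp)), h y (hmem (by simp)) (hmem (by simp))]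
  rcases ht.2.exists_scalar_or_infinite hμ.op hbt (of_nonneg _) hf with ⟨rb, hrb⟩ | h
  swap
  · rw [h x (hmem (by simp)) (hmem (by simp [opOperation])),
      h y (hmem (by simp)) (hmem (by simp [opOperation]))]
  have hab := hla b (hmem (by simp)) (hmem (by simp [x]))
  have hab' := hrb a (hmem (by simp)) (hmem (by simp [x, opOperation]))
  have hba := hlb a (hmem (by simp)) (hmem (by simp [y]))
  have hba' := hra b (hmem (by simp)) (hmem (by simp [y, opOperation]))
  have haa := hla a (hmem (by simp)) (hmem (by simp))
  have haa' := hra a (hmem (by simp)) (hmem (by simp [opOperation]))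
  simp only [opOperation] at hab' hba' haa'
  by_cases h0 : f (GrothendieckAddGroup.of a) = 0
  · rw [hx, hy, hab', hba, h0, mul_zero, mul_zero]
  · -- comparing the two expressions for `μ a a` shows that the left and right scalars agree
    have hlr : la = ra := mul_right_cancel₀ h0 (haa.symm.trans haa')
    rw [hx, hy, hab, hba', hlr]

end Multiplication

end MonoidLocalization

theorem mainTheorem1 {M : Type*} [AddCommMonoid M] (μ : M → M → M)
    (hμ : MonoidLocalization.IsBiadditive μ)
    (hloc : MonoidLocalization.IsWeaklyLocalizable M μ) :
    (∀ a b : M, MonoidLocalization.AsympEquiv (μ a b) (μ b a)) ∧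
      (∀ a b c : M, MonoidLocalization.AsympEquiv (μ (μ a b) c) (μ a (μ b c))) :=
  ⟨MonoidLocalization.asympEquiv_comm hμ hloc, MonoidLocalization.asympEquiv_assoc hμ hloc⟩
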